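/- Let $\lambda$ be a regular uncountable cardinal with $2^\lambda>\lambda^+$. Let $S\subseteq\{\delta<\lambda^+:\operatorname{cf}\delta=\lambda\}$ be a stationary subset of $\lambda^+$, and let $\bar C=\langle C_\delta:\delta\in S\rangle$ be such that each $C_\delta$ is a club (closed unbounded subset) of $\delta$. For a set $C$ of ordinals let $\operatorname{nacc}C$ be the set of those elements of $C$ that are not accumulation points of $C$. Assume: 1. $\bar C$ guesses clubs: for every club $E$ of $\lambda^+$ there is $\delta\in S\cap E$ with $C_\delta\subseteq E$; 2. for every $\alpha<\lambda^+$, the set $\{C_\delta\cap\alpha:\delta\in S,\ \alpha\in\operatorname{nacc}C_\delta\}$ has cardinality at most $\lambda$. Then: (a) there is no universal linear order in $\lambda^+$, i.e. no linear order of cardinality $\lambda^+$ into which every linear order of cardinality $\lambda^+$ embeds; (b) moreover, $\operatorname{univ}(\lambda^+,T_{\mathrm{ord}})\ge 2^\lambda$, where $T_{\mathrm{ord}}$ is the theory of linear orders and $\operatorname{univ}(\mu,T_{\mathrm{ord}})$ is the least cardinality of a set $\mathcal P$ of linear orders of cardinality $\mu$ such that every linear order of cardinality $\mu$ embeds into some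 member of $\mathcal P$. -/

import Mathlib

open Cardinal Ordinal Set FirstOrder Topology Filter

universe u

/-- `C` is a club of the ordinal `δ`: a subset of `δ` that is closed and cofinal in `δ`. -/
def IsClubIn (C : Set Ordinal.{u}) (δ : Ordinal.{u}) : Prop :=
  C ⊆ Iio δ ∧ IsClub ((fun x : Iio δ => (x : Ordinal.{u})) ⁻¹' C)

/-- `S` is a stationary subset of the ordinal `μ`: a subset of `μ` meeting every club of `μ`. -/
def IsStationaryIn (S : Set Ordinal.{u}) (μ : Ordinal.{u}) : Prop :=
  S ⊆ Iio μ ∧ IsStationary ((fun x : Iio μ => (x : Ordinal.{u})) ⁻¹' S)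

/-- `nacc C`: the elements of `C` that are not accumulation points of `C`
(in the order topology of the ordinals). -/
def nacc (C : Set Ordinal.{u}) : Set Ordinal.{u} :=
  {α ∈ C | ¬ AccPt α (𝓟 C)}

/-- `⟨C δ : δ ∈ S⟩` is an `S`-club system: `C δ` is a club of `δ` for every `δ ∈ S`. -/
def IsClubSystem (S : Set Ordinal.{u}) (C : Ordinal.{u} → Set Ordinal.{u}) : Prop :=
  ∀ δ ∈ S, IsClubIn (C δ) δ

/-- The club system `⟨C δ : δ ∈ S⟩` guesses clubs of `μ`, i.e. `μ ∉ id^a(C)`: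
for every club `E` of `μ` there is `δ ∈ S ∩ E` with `C δ ⊆ E`. -/
def GuessesClubs (μ : Ordinal.{u}) (S : Set Ordinal.{u})
    (C : Ordinal.{u} → Set Ordinal.{u}) : Prop :=
  ∀ E : Set Ordinal.{u}, IsClubIn E μ → ∃ δ ∈ S ∩ E, C δ ⊆ E

/-- `univ(μ, T)` for a universal theory `T` (models of `T` with embeddings): the least
cardinality of a set `P` of models of `T` of cardinality `μ` such that every model of `T` of
cardinality `μ` embeds into a member of `P`. Since the models of `T` in `Type u` form a type in
`Type (u + 1)`, so does `P`, and the value is a cardinal of that universe. -/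
noncomputable def univNumber {L : FirstOrder.Language.{0, 0}} (μ : Cardinal.{u}) (T : L.Theory) :
    Cardinal.{u + 1} :=
  sInf {κ | ∃ P : Set (FirstOrder.Language.Theory.ModelType.{0, 0, u} T),
    #P = κ ∧ (∀ M ∈ P, #M = μ) ∧
    ∀ N : FirstOrder.Language.Theory.ModelType.{0, 0, u} T, #N = μ → ∃ M ∈ P, Nonempty (N ↪[L] M)}

/-- `M` is a universal linear order in cardinality `μ`: it has cardinality `μ`, and every linear
order of cardinality `μ` embeds into it. -/
def IsUniversalLinearOrder (μ : Cardinal.{u}) (M : Type u) [LinearOrder M] : Prop :=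
  #M = μ ∧ ∀ (N : Type u) [LinearOrder N], #N = μ → Nonempty (N ↪o M)

/-- `T_ord`, the first-order theory of linear orders. -/
def Tord : FirstOrder.Language.order.Theory := FirstOrder.Language.order.linearOrderTheory

/-! The proof attaches to points of a linear order of size `λ⁺` subsets of `λ` that embeddings
preserve, and builds for each `A ⊆ λ` an order in which `A` must occur.

Write an order `M` as an increasing union of parts `M_α`, `α < λ⁺`, of size at most `λ`. For `x` in
`M` and `β < α`, ask whether the cut of `x` over `M_β` is realized in `M_α`. For an embedding `f : N
↪o M` the answers for `x` and `f x` agree for all `β < α` in some club `E`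
(`exists_isClubIn_sameCut_iff`). Fix in each `C_δ` pairs `m₂ δ j < m₃ δ j`, `j < λ`; the set of `j`
for which the answer at this pair is positive is the invariant of `x` at `δ`. If `C_δ ⊆ E`, then `x`
and `f x` have the same invariant at `δ`.

For given `A`, `CodeOrder` consists of lexicographically ordered `λ`-sequences: one sequence for
each `δ ∈ S`, whose invariant at `δ` is exactly `A` (`exists_sameCut_codeSeq_iff`), and truncations
of these. The bound on the traces `C_δ ∩ α` keeps the parts of this order of size at most `λ`
(`isFiltrationRank_codeRank`).

Since `λ⁺ < 2^λ`, fewer than `2^λ` orders of size `λ⁺` have fewer than `2^λ` invariants altogether.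
Some `A` is missed, and by club guessing the order built for `A` embeds into none of them. Both
conclusions follow. -/

/-- A rank function on `W` with values below `λ⁺`, all of whose proper initial parts have
cardinality at most `λ`: it presents `W` as an increasing union of `λ⁺` sets of size `≤ λ`. -/
structure IsFiltrationRank (lam : Cardinal.{u}) {W : Type u} (r : W → Ordinal.{u}) : Prop where
  lt (w : W) : r w < (Order.succ lam).ord
  card_le (α : Ordinal.{u}) (hα : α < (Order.succ lam).ord) : #{w // r w < α} ≤ lam

/-! ### Filtrations of length `λ⁺` and closure clubs. -/

section Clubs

variable {lam : Cardinal.{u}}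

theorem card_le_of_lt_ord_succ {α : Ordinal.{u}} (hα : α < (Order.succ lam).ord) :
    α.card ≤ lam :=
  Order.lt_succ_iff.1 (Cardinal.lt_ord.1 hα)

/-- The rank of `λ⁺` itself. -/
noncomputable def toTypeRank {μ : Ordinal.{u}} (b : μ.ToType) : Ordinal.{u} :=
  (ToType.mk.symm b : Iio μ)

theorem toTypeRank_lt {μ : Ordinal.{u}} (b : μ.ToType) : toTypeRank b < μ :=
  (ToType.mk.symm b : Iio μ).2

theorem toTypeRank_injective {μ : Ordinal.{u}} :
    Function.Injective (toTypeRank : μ.ToType → Ordinal.{u}) :=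
  Subtype.val_injective.comp ToType.mk.symm.injective

theorem exists_toTypeRank_eq {μ α : Ordinal.{u}} (h : α < μ) : ∃ b : μ.ToType, toTypeRank b = α :=
  ⟨ToType.mk ⟨α, h⟩, by simp [toTypeRank]⟩

theorem lift_card_le_of_injective {W : Type u} {α : Ordinal.{u}} {s : Set W}
    (r : s → Ordinal.{u}) (hr : Function.Injective r) (h : ∀ w, r w < α) : #s ≤ α.card := by
  rw [← Cardinal.lift_le.{u + 1}, ← Cardinal.mk_Iio_ordinal]
  refine (Cardinal.mk_le_of_injective
    (α := ULift.{u + 1} s) (β := Iio α) (f := fun w => ⟨r w.down, h w.down⟩) ?_)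
  intro a b hab
  exact ULift.down_injective (hr (congrArg Subtype.val hab))

theorem isFiltrationRank_of_injective {W : Type u} (r : W → Ordinal.{u})
    (hr : Function.Injective r) (h : ∀ w, r w < (Order.succ lam).ord) : IsFiltrationRank lam r where
  lt := h
  card_le α hα := (lift_card_le_of_injective (s := {w | r w < α}) (fun w => r w)
    (fun _ _ hab => Subtype.ext (hr hab)) (fun w => w.2)).trans (card_le_of_lt_ord_succ hα)

theorem isFiltrationRank_toTypeRank :
    IsFiltrationRank lam (toTypeRank (μ := (Order.succ lam).ord)) :=
  isFiltrationRank_of_injective _ toTypeRank_injective toTypeRank_lt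

theorem IsFiltrationRank.prod (hlam : ℵ₀ ≤ lam) {W W' : Type u} {r : W → Ordinal.{u}}
    {r' : W' → Ordinal.{u}} (h : IsFiltrationRank lam r) (h' : IsFiltrationRank lam r') :
    IsFiltrationRank lam (fun p : W × W' => max (r p.1) (r' p.2)) where
  lt p := max_lt (h.lt _) (h'.lt _)
  card_le α hα := by
    calc #{p : W × W' // max (r p.1) (r' p.2) < α}
        ≤ #({w // r w < α} × {w // r' w < α}) :=
          Cardinal.mk_le_of_injective
            (f := fun p => (⟨p.1.1, (max_lt_iff.1 p.2).1⟩, ⟨p.1.2, (max_lt_iff.1 p.2).2⟩)) (by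
              rintro ⟨⟨a, b⟩, _⟩ ⟨⟨c, d⟩, _⟩ hab
              simpa using hab)
      _ ≤ lam := by
        rw [Cardinal.mk_prod, Cardinal.lift_id, Cardinal.lift_id]
        exact (mul_le_mul' (h.card_le α hα) (h'.card_le α hα)).trans
          (Cardinal.mul_eq_self hlam).le

/-- A rank below a supremum is already below some member, which gives closedness. For unboundedness,
iterate `ω` times the map that bounds `g` on a part of size at most `λ`; regularity of `λ⁺` keeps
all bounds below `λ⁺`. -/
theorem isClubIn_closure (hlam : ℵ₀ ≤ lam) {W : Type u} {r : W → Ordinal.{u}}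
    (hr : IsFiltrationRank lam r) (g : W → Ordinal.{u}) (hg : ∀ w, g w < (Order.succ lam).ord) :
    IsClubIn {α | α < (Order.succ lam).ord ∧ ∀ w, r w < α → g w < α} (Order.succ lam).ord := by
  have hreg := isRegular_succ hlam
  refine ⟨fun α hα => hα.1, ⟨?_, ?_⟩⟩
  · intro d hd _ _ a ha
    refine ⟨a.2, fun w hw => ?_⟩
    obtain ⟨b, hb, hwb⟩ : ∃ b ∈ d, r w < (b : Ordinal) := by
      by_contra! hcon
      have : a ≤ (⟨r w, hr.lt w⟩ : Iio _) := ha.2 fun b hb => hcon b hb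
      exact absurd hw (not_lt.2 this)
    exact ((hd hb).2 w hwb).trans_le (ha.1 hb)
  · rintro ⟨a, ha⟩
    let f : Ordinal.{u} → Ordinal.{u} := fun ξ => max ξ (⨆ w : {w // r w < ξ}, (g w + 1))
    have hf : ∀ i < (Order.succ lam).ord, f i < (Order.succ lam).ord := fun i hi =>
      max_lt hi (iSup_add_one_lt_of_lt_cof
        (by rw [hreg.cof_ord]; exact (hr.card_le i hi).trans_lt (Order.lt_succ lam))
        (fun w => hg w))
    have hlt : nfp f a < (Order.succ lam).ord :=
      nfp_lt_ord (by rw [hreg.cof_ord]; exact hlam.trans_lt (Order.lt_succ lam)) hf ha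
    refine ⟨⟨nfp f a, hlt⟩, ⟨hlt, fun w hw => ?_⟩, le_nfp f a⟩
    obtain ⟨n, hn⟩ := lt_nfp_iff.1 hw
    refine lt_nfp_iff.2 ⟨n + 1, ?_⟩
    rw [Function.iterate_succ_apply']
    refine lt_of_lt_of_le ?_ (le_max_right _ _)
    exact (lt_add_one _).trans_le
      (Ordinal.le_iSup (fun w : {w // r w < f^[n] a} => g w + 1) ⟨w, hn⟩)

theorem IsClubIn.inter (hlam : ℵ₀ ≤ lam) {E F : Set Ordinal.{u}}
    (hE : IsClubIn E (Order.succ lam).ord) (hF : IsClubIn F (Order.succ lam).ord) :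
    IsClubIn (E ∩ F) (Order.succ lam).ord := by
  refine ⟨fun α hα => hE.1 hα.1, ?_⟩
  rw [preimage_inter]
  refine IsClub.inter ?_ hE.2 hF.2
  rw [cof_Iio, ← lift_cof, (isRegular_succ hlam).cof_ord]
  intro h
  have : Order.succ lam = ℵ₀ := by
    rw [← Cardinal.lift_inj.{u, u + 1}, h, Cardinal.lift_aleph0]
  exact (hlam.trans_lt (Order.lt_succ lam)).ne' this

/-- Club many ordinals `α` reflect a given existential statement with parameters of rank
below `α`. -/
theorem exists_isClubIn_witness (hlam : ℵ₀ ≤ lam) {W X : Type u} {r : W → Ordinal.{u}}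
    (hr : IsFiltrationRank lam r) {s : X → Ordinal.{u}} (hs : IsFiltrationRank lam s)
    (R : W → X → Prop) :
    ∃ E, IsClubIn E (Order.succ lam).ord ∧
      ∀ α ∈ E, ∀ w, r w < α → (∃ x, R w x) → ∃ x, s x < α ∧ R w x := by
  classical
  refine ⟨_, isClubIn_closure hlam hr
    (fun w => if h : ∃ x, R w x then s h.choose else 0) ?_, ?_⟩
  · intro w
    split_ifs with h
    · exact hs.lt _
    · exact (isRegular_succ hlam).ord_pos
  · rintro α ⟨_, hα⟩ w hw h
    have := hα w hw
    rw [dif_pos h] at this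
    exact ⟨h.choose, this, h.choose_spec⟩

end Clubs

/-! ### Cuts over small parts are preserved by embeddings. -/

section Invariants

/-- No element of `P` separates `a` from `b`. -/
def SameCut {M : Type u} [LinearOrder M] (P : M → Prop) (a b : M) : Prop :=
  ∀ z, P z → (z < a ↔ z < b) ∧ (a < z ↔ b < z)

variable {lam : Cardinal.{u}} {N M : Type u} [LinearOrder N] [LinearOrder M]
  {rN : N → Ordinal.{u}} {rM : M → Ordinal.{u}}

/-- The case in which `f` splits a cut: `z` in `M_β` separates `f x` from `f y`. Every `w` in `N_β`
with `f w < z` lies below `y`, hence below `x`. Being mapped below `z` while exceeding all such `w`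
is a condition with parameters `z` and `β` only, so it reflects to some `x'` in `N_α`, and it
already determines the cut of the image over `M_β`. -/
theorem exists_isClubIn_sameCut_of_lt (hlam : ℵ₀ ≤ lam) (hN : IsFiltrationRank lam rN)
    (hM : IsFiltrationRank lam rM) (f : N ↪o M) :
    ∃ E, IsClubIn E (Order.succ lam).ord ∧ ∀ β ∈ E, ∀ α ∈ E, β < α → ∀ x y z,
      SameCut (fun w => rN w < β) y x → rM z < β → f x < z → z < f y →
      ∃ x', rN x' < α ∧ SameCut (fun w => rM w < β) (f x') (f x) := by
  obtain ⟨E₁, hE₁, h₁⟩ := exists_isClubIn_witness hlam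
    (hM.prod hlam isFiltrationRank_toTypeRank) hN
    (fun p x => f x < p.1 ∧ ∀ w, rN w < toTypeRank p.2 → f w < p.1 → w < x)
  obtain ⟨E₂, hE₂, h₂⟩ := exists_isClubIn_witness hlam (hM.prod hlam hM) hN
    (fun p w => p.1 ≤ f w ∧ f w < p.2)
  refine ⟨E₁ ∩ E₂, hE₁.inter hlam hE₂, ?_⟩
  rintro β hβ α hα hβα x y z hxy hz hxz hzy
  have hx : ∀ w, rN w < β → f w < z → w < x := fun w hw hwz =>
    (hxy w hw).1.1 (f.lt_iff_lt.1 (hwz.trans hzy))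
  obtain ⟨b, rfl⟩ := exists_toTypeRank_eq (hE₁.1 hβ.1)
  obtain ⟨x', hx'α, hx'z, hx'⟩ := h₁ α hα.1 (z, b) (max_lt (hz.trans hβα) hβα) ⟨x, hxz, hx⟩
  refine ⟨x', hx'α, fun z' hz' => ?_⟩
  rcases le_or_gt z z' with hzz | hzz
  · have h1 := hx'z.trans_le hzz
    have h2 := hxz.trans_le hzz
    exact ⟨iff_of_false h1.not_gt h2.not_gt, iff_of_true h1 h2⟩
  -- If the image of `f` meets `[z', z)`, it does so at a point of `N_β`, which puts both images
  -- above `z'`. Otherwise both images, being below `z`, must be below `z'`.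
  by_cases hw : ∃ w, z' ≤ f w ∧ f w < z
  · obtain ⟨w, hwβ, hw1, hw2⟩ := h₂ _ hβ.2 (z', z) (max_lt hz' hz) hw
    have h1 := hw1.trans_lt (f.lt_iff_lt.2 (hx' w hwβ hw2))
    have h2 := hw1.trans_lt (f.lt_iff_lt.2 (hx w hwβ hw2))
    exact ⟨iff_of_true h1 h2, iff_of_false h1.not_gt h2.not_gt⟩
  · push Not at hw
    have h1 : f x' < z' := not_le.1 fun h => (hw _ h).not_gt hx'z
    have h2 : f x < z' := not_le.1 fun h => (hw _ h).not_gt hxz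
    exact ⟨iff_of_false h1.not_gt h2.not_gt, iff_of_true h1 h2⟩

/-- Order embeddings preserve, on a club, the property that the cut of `x` over the part of rank
below `β` is realized at rank below `α`. -/
theorem exists_isClubIn_sameCut_iff (hlam : ℵ₀ ≤ lam) (hN : IsFiltrationRank lam rN)
    (hM : IsFiltrationRank lam rM) (f : N ↪o M) :
    ∃ E, IsClubIn E (Order.succ lam).ord ∧ ∀ β ∈ E, ∀ α ∈ E, β < α → ∀ x,
      ((∃ y, rN y < α ∧ SameCut (fun w => rN w < β) y x) ↔
        ∃ y, rM y < α ∧ SameCut (fun w => rM w < β) y (f x)) := by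
  obtain ⟨E₁, hE₁, h₁⟩ := exists_isClubIn_witness hlam hN hM (fun w z => f w = z)
  obtain ⟨E₂, hE₂, h₂⟩ := exists_isClubIn_witness hlam hM hN (fun z w => f w = z)
  obtain ⟨E₃, hE₃, h₃⟩ := exists_isClubIn_witness hlam
    (hM.prod hlam isFiltrationRank_toTypeRank) hN
    (fun p x => SameCut (fun w => rM w < toTypeRank p.2) p.1 (f x))
  obtain ⟨E₄, hE₄, h₄⟩ := exists_isClubIn_sameCut_of_lt hlam hN hM f
  obtain ⟨E₅, hE₅, h₅⟩ := exists_isClubIn_sameCut_of_lt (N := Nᵒᵈ) (M := Mᵒᵈ) (rN := rN)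
    (rM := rM) hlam hN hM f.dual
  refine ⟨(E₁ ∩ E₂) ∩ (E₃ ∩ (E₄ ∩ E₅)),
    (hE₁.inter hlam hE₂).inter hlam (hE₃.inter hlam (hE₄.inter hlam hE₅)), ?_⟩
  rintro β ⟨⟨hβ₁, hβ₂⟩, hβ₃, hβ₄, hβ₅⟩ α ⟨⟨hα₁, hα₂⟩, hα₃, hα₄, hα₅⟩ hβα x
  have hf : ∀ γ ∈ E₁, ∀ w, rN w < γ → rM (f w) < γ := by
    intro γ hγ w hw
    obtain ⟨_, h, rfl⟩ := h₁ γ hγ w hw ⟨_, rfl⟩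
    exact h
  have hf' : ∀ w, rM (f w) < β → rN w < β := by
    intro w hw
    obtain ⟨w', h, hw'⟩ := h₂ β hβ₂ (f w) hw ⟨w, rfl⟩
    rwa [← f.injective hw']
  constructor
  · rintro ⟨y, hyα, hyx⟩
    by_cases hcut : SameCut (fun w => rM w < β) (f y) (f x)
    · exact ⟨f y, hf α hα₁ y hyα, hcut⟩
    have hne : x ≠ y := by
      rintro rfl
      exact hcut fun z _ => ⟨Iff.rfl, Iff.rfl⟩
    have hxβ : ¬ rN x < β := fun h => by
      rcases lt_or_gt_of_ne hne with h' | h'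
      · exact lt_irrefl x ((hyx x h).1.1 h')
      · exact lt_irrefl x ((hyx x h).2.1 h')
    have hyβ : ¬ rN y < β := fun h => by
      rcases lt_or_gt_of_ne hne with h' | h'
      · exact lt_irrefl y ((hyx y h).2.2 h')
      · exact lt_irrefl y ((hyx y h).1.2 h')
    -- Neither `f x` nor `f y` lies in `M_β`, so different cuts over `M_β` mean that a point of
    -- `M_β` is strictly between them.
    have hsep : ∃ z, rM z < β ∧ ((f x < z ∧ z < f y) ∨ (f y < z ∧ z < f x)) := by
      by_contra! hcon
      refine hcut fun z hz => ?_
      have hzx : z ≠ f x := by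
        rintro rfl
        exact hxβ (hf' x hz)
      have hzy : z ≠ f y := by
        rintro rfl
        exact hyβ (hf' y hz)
      have := hcon z hz
      grind
    obtain ⟨z, hz, ⟨h1, h2⟩ | ⟨h1, h2⟩⟩ := hsep
    · obtain ⟨x', hx', hcut'⟩ := h₄ β hβ₄ α hα₄ hβα x y z hyx hz h1 h2
      exact ⟨f x', hf α hα₁ x' hx', hcut'⟩
    -- The mirror image of the previous case, obtained from the dual orders.
    · obtain ⟨x', hx', hcut'⟩ := h₅ β hβ₅ α hα₅ hβα (OrderDual.toDual x) (OrderDual.toDual y)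
        (OrderDual.toDual z) (fun w hw => (hyx w hw).symm) hz h2 h1
      exact ⟨f x', hf α hα₁ x' hx', fun w hw => (hcut' w hw).symm⟩
  · rintro ⟨y, hyα, hyx⟩
    obtain ⟨b, rfl⟩ := exists_toTypeRank_eq (hE₁.1 hβ₁)
    -- Realizing the `M_β`-cut of `y` by a point `f x'` is a condition on `y` and `β`, so `x'` can
    -- be found in `N_α`. The cut pulls back to `N_β` because `f` maps `N_β` into `M_β`.
    obtain ⟨x', hx'α, hx'⟩ := h₃ α hα₃ (y, b) (max_lt hyα hβα) ⟨x, hyx⟩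
    refine ⟨x', hx'α, fun w hw => ?_⟩
    have h := hyx (f w) (hf _ hβ₁ w hw)
    have h' := hx' (f w) (hf _ hβ₁ w hw)
    simp only [f.lt_iff_lt] at h h'
    exact ⟨h'.1.symm.trans h.1, h'.2.symm.trans h.2⟩

end Invariants

/-! ### The order of digits. -/

section Digits

theorem IsFiltrationRank.sum {lam : Cardinal.{u}} (hlam : ℵ₀ ≤ lam) {W W' : Type u}
    {r : W → Ordinal.{u}} {r' : W' → Ordinal.{u}} (h : IsFiltrationRank lam r)
    (h' : IsFiltrationRank lam r') : IsFiltrationRank lam (Sum.elim r r') where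
  lt w := by cases w with
    | inl w => exact h.lt w
    | inr w => exact h'.lt w
  card_le α hα := by
    calc #{p : W ⊕ W' // Sum.elim r r' p < α}
        = #({w // r w < α} ⊕ {w // r' w < α}) := Cardinal.mk_congr Equiv.subtypeSum
      _ ≤ lam := by
        rw [Cardinal.mk_sum, Cardinal.lift_id, Cardinal.lift_id]
        exact (add_le_add (h.card_le α hα) (h'.card_le α hα)).trans
          (Cardinal.add_eq_self hlam).le

theorem IsFiltrationRank.comp_injective {lam : Cardinal.{u}} {W W' : Type u}
    {r : W → Ordinal.{u}} (h : IsFiltrationRank lam r) {f : W' → W} (hf : Function.Injective f) :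
    IsFiltrationRank lam (r ∘ f) where
  lt w := h.lt (f w)
  card_le α hα := (Cardinal.mk_le_of_injective
    (f := fun w : {w // r (f w) < α} => (⟨f w, w.2⟩ : {w // r w < α}))
    fun _ _ hab => Subtype.ext (hf (congrArg Subtype.val hab))).trans (h.card_le α hα)

theorem isFiltrationRank_zero {lam : Cardinal.{u}} (hlam : ℵ₀ ≤ lam) {W : Type u} (h : #W ≤ lam) :
    IsFiltrationRank lam (fun _ : W => (0 : Ordinal.{u})) where
  lt _ := (isRegular_succ hlam).ord_pos
  card_le _ _ := (Cardinal.mk_subtype_le _).trans h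

/-- The functions from `I` to `Bool` that are constant above some point. -/
def eventuallyConstant (I : Type u) [LinearOrder I] : Set (Lex (I → Bool)) :=
  {f | ∃ i b, ∀ j, i < j → f j = b}

/-- Follow `a` through the first difference `i` with `b`, then continue with constant `false` if `b
< a` and constant `true` if `a < b`. The result differs from `a` because `a` is not eventually
constant. -/
theorem exists_eventuallyConstant_between {I : Type u} [LinearOrder I] [WellFoundedLT I]
    {a b : Lex (I → Bool)} (ha : a ∉ eventuallyConstant I) (hab : b ≠ a) :
    ∃ q ∈ eventuallyConstant I, (b < q ∧ q < a) ∨ (a < q ∧ q < b) := by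
  classical
  rcases lt_or_gt_of_ne hab with ⟨i, hi, hlt⟩ | ⟨i, hi, hlt⟩
  · let q : Lex (I → Bool) := toLex fun j => if j ≤ i then a j else false
    have hq : q ∈ eventuallyConstant I := ⟨i, false, fun j hj => if_neg hj.not_ge⟩
    refine ⟨q, hq, Or.inl ⟨⟨i, fun j hj => (hi j hj).trans (if_pos hj.le).symm, ?_⟩, ?_⟩⟩
    · exact hlt.trans_eq (if_pos le_rfl).symm
    · refine lt_of_le_of_ne (Pi.toLex_monotone (a := ofLex q) (b := ofLex a) fun j => ?_) ?_
      · by_cases hj : j ≤ i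
        · exact (if_pos hj).le
        · exact (if_neg hj).trans_le (Bool.false_le _)
      · intro h
        exact ha (h ▸ hq)
  · let q : Lex (I → Bool) := toLex fun j => if j ≤ i then a j else true
    have hq : q ∈ eventuallyConstant I := ⟨i, true, fun j hj => if_neg hj.not_ge⟩
    refine ⟨q, hq, Or.inr ⟨?_, ⟨i, fun j hj => (if_pos hj.le).trans (hi j hj), ?_⟩⟩⟩
    · refine lt_of_le_of_ne (Pi.toLex_monotone (a := ofLex a) (b := ofLex q) fun j => ?_) ?_
      · by_cases hj : j ≤ i
        · exact (if_pos hj).ge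
        · exact (Bool.le_true _).trans_eq (if_neg hj).symm
      · intro h
        exact ha (h ▸ hq)
    · exact (if_pos le_rfl).trans_lt hlt

/-- Such a function is determined by a point `i`, its restriction below `i` (at most `λ` choices, as
fewer than `κ` coordinates are involved), its value at `i` and its tail value. -/
theorem mk_eventuallyConstant_le {lam κ : Cardinal.{u}} (hlam : ℵ₀ ≤ lam) (hκ : κ ≤ lam)
    (h : ∀ ν < κ, 2 ^ ν ≤ lam) : #(eventuallyConstant κ.ord.ToType) ≤ lam := by
  classical
  let I := κ.ord.ToType
  let F : (Σ i : I, (Iio i → Bool) × (Bool × Bool)) → Lex (I → Bool) := fun p =>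
    toLex fun j => if hj : j < p.1 then p.2.1 ⟨j, hj⟩ else if j = p.1 then p.2.2.1 else p.2.2.2
  have hF : eventuallyConstant I ⊆ range F := by
    rintro f ⟨i, b, hf⟩
    refine ⟨⟨i, fun j => f j, f i, b⟩, ?_⟩
    funext j
    change (if hj : j < i then f j else if j = i then f i else b) = f j
    split_ifs with h1 h2
    · rfl
    · rw [h2]
    · exact (hf j (lt_of_le_of_ne (not_lt.1 h1) (Ne.symm h2))).symm
  refine (Cardinal.mk_le_mk_of_subset hF).trans (Cardinal.mk_range_le.trans ?_)
  rw [Cardinal.mk_sigma]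
  refine (Cardinal.sum_le_sum _ (fun _ => lam) fun i => ?_).trans ?_
  · have hi : #(Iio i) < κ := by
      have hi := mk_Iio_lt i (by rw [type_toType, Cardinal.mk_ord_toType])
      rwa [Cardinal.mk_ord_toType] at hi
    rw [Cardinal.mk_prod, Cardinal.lift_uzero]
    refine (mul_le_mul' ?_ ?_).trans (Cardinal.mul_eq_self hlam).le
    · simpa using h _ hi
    · refine le_trans ?_ hlam
      rw [Cardinal.lift_le_aleph0]
      exact Cardinal.mk_le_aleph0
  · rw [Cardinal.sum_const, Cardinal.lift_id, Cardinal.lift_id, Cardinal.mk_ord_toType]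
    exact (mul_le_mul' hκ le_rfl).trans (Cardinal.mul_eq_self hlam).le

/-- A linear order of digits: the digits of rank `0` separate each digit `c ε` from every other
digit, and the digits `d ε` exceed all digits of smaller rank. -/
structure DigitSystem (lam : Cardinal.{u}) (K : Type u) [LinearOrder K] where
  rank : K → Ordinal.{u}
  isFiltrationRank : IsFiltrationRank lam rank
  bot : K
  top : K
  c : Ordinal.{u} → K
  d : Ordinal.{u} → K
  rank_bot : rank bot = 0
  rank_top : rank top = 0
  rank_c (ε : Ordinal.{u}) : ε < (Order.succ lam).ord → rank (c ε) = ε + 1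
  rank_d (ε : Ordinal.{u}) : ε < (Order.succ lam).ord → rank (d ε) = ε
  bot_lt_c (ε : Ordinal.{u}) : ε < (Order.succ lam).ord → bot < c ε
  c_lt_top (ε : Ordinal.{u}) : ε < (Order.succ lam).ord → c ε < top
  lt_d (ε : Ordinal.{u}) : ε < (Order.succ lam).ord → ∀ k, rank k < ε → k < d ε
  separated (ε : Ordinal.{u}) : ε < (Order.succ lam).ord → ∀ k, k ≠ c ε →
    ∃ q, rank q = 0 ∧ ((k < q ∧ q < c ε) ∨ (c ε < q ∧ q < k))

/-- Take `κ` least with `2^κ > λ`. In the lexicographic order on `2^κ` the eventually constant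
functions number at most `λ` and separate every other function from everything else; these are the
separators of rank `0`. More than `λ` functions remain, enough for the digits `c ε`. -/
theorem exists_digitSystem {lam : Cardinal.{u}} (hlam : ℵ₀ ≤ lam) :
    ∃ (K : Type u) (_ : LinearOrder K), Nonempty (DigitSystem lam K) := by
  classical
  obtain ⟨κ, hκ, hmin⟩ := WellFounded.has_min (wellFounded_lt (α := Cardinal.{u}))
    {ν | lam < 2 ^ ν} ⟨lam, Cardinal.cantor lam⟩
  have hκlam : κ ≤ lam := not_lt.1 fun h => hmin lam (Cardinal.cantor lam) h
  have hsmall : ∀ ν < κ, 2 ^ ν ≤ lam := fun ν hν => not_lt.1 fun h => hmin ν h hν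
  have hκ0 : κ ≠ 0 := by
    rintro rfl
    have : lam < 1 := by simpa using hκ
    exact absurd (hlam.trans_lt this) (not_lt.2 Cardinal.one_lt_aleph0.le)
  let I := κ.ord.ToType
  let Q := eventuallyConstant I
  have hQ : #Q ≤ lam := mk_eventuallyConstant_le hlam hκlam hsmall
  obtain ⟨i₀⟩ : Nonempty I := by
    rw [← Cardinal.mk_ne_zero_iff, Cardinal.mk_ord_toType]
    exact hκ0
  have hcompl : Order.succ lam ≤ #(Qᶜ : Set (Lex (I → Bool))) := by
    refine Order.succ_le_of_lt (not_le.1 fun hle => ?_)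
    have h1 : #(Lex (I → Bool)) = 2 ^ κ := by
      change #(I → Bool) = _
      simp [I]
    have h2 := Cardinal.mk_sum_compl Q
    rw [h1] at h2
    have h3 : lam < #Q + #(Qᶜ : Set (Lex (I → Bool))) := h2 ▸ hκ
    exact (h3.trans_le (add_le_add hQ hle)).ne (Cardinal.add_eq_self hlam).symm
  have hcompl' : #(Order.succ lam).ord.ToType ≤ #(Qᶜ : Set (Lex (I → Bool))) := by
    rwa [Cardinal.mk_ord_toType]
  obtain ⟨e⟩ := hcompl'
  let T := (Order.succ lam).ord.ToType
  have : Nonempty T := by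
    rw [← Cardinal.mk_ne_zero_iff, Cardinal.mk_ord_toType]
    exact (isRegular_succ hlam).pos.ne'
  obtain ⟨K, ⟨eK⟩⟩ : ∃ K : Type u, Nonempty (K ≃ (Q ⊕ T) ⊕ T) := ⟨_, ⟨Equiv.refl _⟩⟩
  -- The order on `K` is pulled back from `2^κ` followed by a copy of `λ⁺`: separators and the `c ε`
  -- lie in the first summand, the `d ε` in the second.
  let φ : K → Lex (Lex (I → Bool) ⊕ T) := fun k => toLex
    (Sum.map (Sum.elim (fun q : Q => (q : Lex (I → Bool))) (fun t => (e t : Lex (I → Bool)))) id (eK k))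
  have hφ : Function.Injective φ := by
    refine toLex.injective.comp
      ((Sum.map_injective.2 ⟨?_, Function.injective_id⟩).comp eK.injective)
    refine Function.Injective.sumElim Subtype.val_injective
      (Subtype.val_injective.comp e.injective) ?_
    intro q t h
    exact (e t).2 (h ▸ q.2)
  let : LinearOrder K := LinearOrder.lift' φ hφ
  have hlt : ∀ k k' : K, k < k' ↔ φ k < φ k' := fun _ _ => Iff.rfl
  choose! g hg using fun (ε : Ordinal.{u}) (h : ε < (Order.succ lam).ord) =>
    exists_toTypeRank_eq h
  have hT0 : toLex (fun _ : I => false) ∈ Q := ⟨i₀, false, fun _ _ => rfl⟩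
  have hT1 : toLex (fun _ : I => true) ∈ Q := ⟨i₀, true, fun _ _ => rfl⟩
  refine ⟨K, inferInstance, ⟨{
    rank := Sum.elim (Sum.elim (fun _ => 0) (fun t => toTypeRank t + 1)) toTypeRank ∘ eK
    isFiltrationRank := (((isFiltrationRank_zero hlam hQ).sum hlam
      (isFiltrationRank_of_injective _ (fun a b hab => toTypeRank_injective
        (by simpa using hab)) fun t => ?_)).sum hlam isFiltrationRank_toTypeRank).comp_injective
      eK.injective
    bot := eK.symm (Sum.inl (Sum.inl ⟨_, hT0⟩))
    top := eK.symm (Sum.inl (Sum.inl ⟨_, hT1⟩))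
    c := fun ε => eK.symm (Sum.inl (Sum.inr (g ε)))
    d := fun ε => eK.symm (Sum.inr (g ε))
    rank_bot := by simp
    rank_top := by simp
    rank_c := fun ε hε => by simp [hg ε hε]
    rank_d := fun ε hε => by simp [hg ε hε]
    bot_lt_c := fun ε hε => ?_
    c_lt_top := fun ε hε => ?_
    lt_d := fun ε hε k hk => ?_
    separated := fun ε hε k hk => ?_ }⟩⟩
  · exact (Cardinal.isSuccLimit_ord (hlam.trans (Order.le_succ lam))).add_one_lt (toTypeRank_lt t)
  · simp only [hlt, φ, Equiv.apply_symm_apply]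
    refine Sum.Lex.inl_lt_inl_iff.2 (lt_of_le_of_ne
      (Pi.toLex_monotone fun j => Bool.false_le _) ?_)
    intro h
    have h' : toLex (fun _ : I => false) = (e (g ε)).1 := h
    exact (e (g ε)).2 (h' ▸ hT0)
  · simp only [hlt, φ, Equiv.apply_symm_apply]
    refine Sum.Lex.inl_lt_inl_iff.2 (lt_of_le_of_ne
      (Pi.toLex_monotone (a := ofLex (e (g ε)).1) fun j => Bool.le_true _) ?_)
    intro h
    have h' : (e (g ε)).1 = toLex (fun _ : I => true) := h
    exact (e (g ε)).2 (h' ▸ hT1)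
  · simp only [hlt, φ, Equiv.apply_symm_apply]
    obtain ⟨k, rfl⟩ := eK.symm.surjective k
    rcases k with k | t
    · simp only [Equiv.apply_symm_apply]
      exact Sum.Lex.inl_lt_inr _ _
    · simp only [Equiv.apply_symm_apply, Function.comp_apply, Sum.elim_inr] at hk ⊢
      refine Sum.Lex.inr_lt_inr_iff.2 ?_
      have h1 : toTypeRank t < toTypeRank (g ε) := hk.trans_eq (hg ε hε).symm
      exact ToType.mk.symm.lt_iff_lt.1 h1
  · obtain ⟨k, rfl⟩ := eK.symm.surjective k
    rcases k with k | t
    · obtain ⟨q, hq, h⟩ := exists_eventuallyConstant_between (e (g ε)).2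
        (b := Sum.elim (fun q : Q => (q : Lex (I → Bool))) (fun t => (e t : Lex (I → Bool))) k)
        (fun h => hk (hφ (by
          simp only [φ, Equiv.apply_symm_apply]
          exact congrArg (fun x => toLex (Sum.inl x)) h)))
      refine ⟨eK.symm (Sum.inl (Sum.inl ⟨q, hq⟩)), by simp, ?_⟩
      simp only [hlt, φ, Equiv.apply_symm_apply]
      exact h.imp
        (And.imp Sum.Lex.inl_lt_inl_iff.2 Sum.Lex.inl_lt_inl_iff.2)
        (And.imp Sum.Lex.inl_lt_inl_iff.2 Sum.Lex.inl_lt_inl_iff.2)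
    · refine ⟨eK.symm (Sum.inl (Sum.inl ⟨_, hT1⟩)), by simp, Or.inr ⟨?_, ?_⟩⟩; swap
      · simp only [hlt, φ, Equiv.apply_symm_apply]
        exact Sum.Lex.inl_lt_inr _ _
      simp only [hlt, φ, Equiv.apply_symm_apply]
      refine Sum.Lex.inl_lt_inl_iff.2 (lt_of_le_of_ne
        (Pi.toLex_monotone (a := ofLex (e (g ε)).1) fun j => Bool.le_true _) ?_)
      intro h
      have h' : (e (g ε)).1 = toLex (fun _ : I => true) := h
      exact (e (g ε)).2 (h' ▸ hT1)

end Digits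

/-! ### Triples of points in the guessing clubs. -/

section Ladders

/-- For every `δ ∈ S` and every index `j < λ`, three consecutive points
`m₁ δ j < m₂ δ j < m₃ δ j` of `C δ`, increasing with `j`, such that for each `γ` at most `λ`
initial parts of the sequence lie below an entry `m₁ δ j = γ`. -/
structure LadderSystem (lam : Cardinal.{u}) (S : Set Ordinal.{u})
    (C : Ordinal.{u} → Set Ordinal.{u}) where
  m₁ : Ordinal.{u} → lam.ord.ToType → Ordinal.{u}
  m₂ : Ordinal.{u} → lam.ord.ToType → Ordinal.{u}
  m₃ : Ordinal.{u} → lam.ord.ToType → Ordinal.{u}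
  lt_of_mem : ∀ δ ∈ S, δ < (Order.succ lam).ord
  m₂_mem : ∀ δ ∈ S, ∀ j, m₂ δ j ∈ C δ
  m₃_mem : ∀ δ ∈ S, ∀ j, m₃ δ j ∈ C δ
  m₁_lt_m₂ : ∀ δ ∈ S, ∀ j, m₁ δ j < m₂ δ j
  m₂_lt_m₃ : ∀ δ ∈ S, ∀ j, m₂ δ j < m₃ δ j
  m₃_lt_m₁ : ∀ δ ∈ S, ∀ i j, i < j → m₃ δ i < m₁ δ j
  m₃_lt : ∀ δ ∈ S, ∀ j, m₃ δ j < δ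
  exists_label : ∀ γ < (Order.succ lam).ord, ∃ (W : Type u) (t : Ordinal.{u} → W), #W ≤ lam ∧
    ∀ δ ∈ S, ∀ δ' ∈ S, ∀ j, m₁ δ j = γ → m₁ δ' j = γ → t δ = t δ' →
      ∀ i < j, m₂ δ i = m₂ δ' i ∧ m₃ δ i = m₃ δ' i

/-- An increasing enumeration below `γ` depends only on the trace of the set below `γ`; hence the
trace `C_δ ∩ γ` can serve as a label for the initial part of a ladder. -/
theorem enumOrd_eq_of_inter_Iio_eq {X Y : Set Ordinal.{u}} (hX : ¬ BddAbove X)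
    (hY : ¬ BddAbove Y) {γ : Ordinal.{u}} (h : X ∩ Iio γ = Y ∩ Iio γ) (i : Ordinal.{u}) :
    enumOrd X i < γ → enumOrd Y i = enumOrd X i := by
  induction i using WellFoundedLT.induction with
  | ind i ih =>
    intro hi
    have hlt : ∀ c < i, enumOrd X c < enumOrd X i := fun c hc => enumOrd_strictMono hX hc
    have heq : ∀ c < i, enumOrd Y c = enumOrd X c := fun c hc => ih c hc ((hlt c hc).trans hi)
    have hmem : enumOrd X i ∈ Y := (h.subset ⟨enumOrd_mem hX i, hi⟩).1
    have hle : enumOrd Y i ≤ enumOrd X i := enumOrd_le_of_forall_lt hmem fun c hc =>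
      (heq c hc).trans_lt (hlt c hc)
    have hmem' : enumOrd Y i ∈ X := (h.superset ⟨enumOrd_mem hY i, hle.trans_lt hi⟩).1
    refine hle.antisymm (enumOrd_le_of_forall_lt hmem' fun c hc => ?_)
    rw [← heq c hc]
    exact enumOrd_strictMono hY hc

theorem not_bddAbove_union_Ici (C : Set Ordinal.{u}) (δ : Ordinal.{u}) :
    ¬ BddAbove (C ∪ Ici δ) := by
  rintro ⟨b, hb⟩
  have h : max b δ + 1 ≤ b := hb (Or.inr ((le_max_right b δ).trans (le_add_right le_rfl)))
  exact absurd ((lt_add_one (max b δ)).trans_le h) (not_lt.2 (le_max_left _ _))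

/-- Adding `Ici δ` makes the set unbounded, so that it can be enumerated by all ordinals. If an
index `i < λ` reached `δ`, the cofinal set `C` would have fewer than `λ` elements, against `cf δ =
λ`. -/
theorem enumOrd_union_Ici_mem {lam : Cardinal.{u}} {C : Set Ordinal.{u}} {δ : Ordinal.{u}}
    (hC : IsClubIn C δ) (hδ : δ.cof = lam) {i : Ordinal.{u}} (hi : i < lam.ord) :
    enumOrd (C ∪ Ici δ) i ∈ C := by
  have hub := not_bddAbove_union_Ici C δ
  refine (enumOrd_mem hub i).resolve_right fun (hle : δ ≤ _) => ?_
  have hcov : C ⊆ enumOrd (C ∪ Ici δ) '' Iio i := by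
    intro x hx
    obtain ⟨k, rfl⟩ := enumOrd_surjective hub (Or.inl hx : x ∈ C ∪ Ici δ)
    exact ⟨k, (enumOrd_lt_enumOrd hub).1 (lt_of_lt_of_le (hC.1 hx) hle), rfl⟩
  have h1 := Order.cof_le hC.2.isCofinal
  rw [cof_Iio, ← lift_cof, hδ] at h1
  have h2 : #((fun x : Iio δ => (x : Ordinal.{u})) ⁻¹' C) ≤ #C :=
    Cardinal.mk_preimage_of_injective _ _ Subtype.val_injective
  have h3 : #C ≤ Cardinal.lift.{u + 1} i.card :=
    (Cardinal.mk_le_mk_of_subset hcov).trans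
      (Cardinal.mk_image_le.trans (Cardinal.mk_Iio_ordinal i).le)
  exact absurd (Cardinal.lift_le.1 (h1.trans (h2.trans h3))) (not_le.2 (Cardinal.lt_ord.1 hi))

theorem enumOrd_union_Ici_add_one_mem_nacc {C : Set Ordinal.{u}} {δ : Ordinal.{u}}
    {i : Ordinal.{u}} (hi : enumOrd (C ∪ Ici δ) (i + 1) ∈ C) :
    enumOrd (C ∪ Ici δ) (i + 1) ∈ nacc C := by
  have hub := not_bddAbove_union_Ici C δ
  refine ⟨hi, fun hacc => ?_⟩
  rw [accPt_iff_nhds] at hacc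
  obtain ⟨y, ⟨hy, hyC⟩, hne⟩ := hacc (Ioo (enumOrd (C ∪ Ici δ) i) (enumOrd (C ∪ Ici δ) (i + 1) + 1))
    (Ioo_mem_nhds (enumOrd_strictMono hub (lt_add_one i)) (lt_add_one _))
  have h1 : enumOrd (C ∪ Ici δ) (i + 1) ≤ y := enumOrd_succ_le hub (Or.inl hyC) hy.1
  exact hne ((Order.lt_add_one_iff.1 hy.2).antisymm h1)

theorem toTypeRank_lt_toTypeRank {μ : Ordinal.{u}} {a b : μ.ToType} :
    toTypeRank a < toTypeRank b ↔ a < b :=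
  ToType.mk.symm.lt_iff_lt

theorem nonempty_ladderSystem {lam : Cardinal.{u}} (hunc : ℵ₀ < lam) {S : Set Ordinal.{u}}
    (hS : S ⊆ Iio (Order.succ lam).ord) (hScof : ∀ δ ∈ S, δ.cof = lam)
    {C : Ordinal.{u} → Set Ordinal.{u}} (hC : IsClubSystem S C)
    (hsmall : ∀ α < (Order.succ lam).ord,
      #{X : Set Ordinal.{u} | ∃ δ ∈ S, α ∈ nacc (C δ) ∧ X = C δ ∩ Iio α}
        ≤ Cardinal.lift.{u + 1} lam) :
    Nonempty (LadderSystem lam S C) := by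
  classical
  let e : Ordinal.{u} → Ordinal.{u} → Ordinal.{u} := fun δ => enumOrd (C δ ∪ Ici δ)
  have he : ∀ δ, StrictMono (e δ) := fun δ => enumOrd_strictMono (not_bddAbove_union_Ici _ _)
  -- The indices are cut into blocks of length `ω`, one for each `j < λ`. Offsets start at `1`
  -- because a successor index yields a point of `nacc (C δ)`, where the hypothesis bounds the
  -- number of traces.
  let m : ℕ → Ordinal.{u} → lam.ord.ToType → Ordinal.{u} :=
    fun n δ j => e δ (ω * toTypeRank j + n)
  have hω : ω < lam.ord := by
    rw [← ord_aleph0]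
    exact Cardinal.ord_lt_ord.2 hunc
  have hidx : ∀ (n : ℕ) (j : lam.ord.ToType), ω * toTypeRank j + n < lam.ord := fun n j =>
    isPrincipal_add_ord hunc.le (isPrincipal_mul_ord hunc.le hω (toTypeRank_lt j))
      ((natCast_lt_omega0 n).trans hω)
  have hmem : ∀ n, ∀ δ ∈ S, ∀ j, m n δ j ∈ C δ := fun n δ hδ j =>
    enumOrd_union_Ici_mem (hC δ hδ) (hScof δ hδ) (hidx n j)
  have hmono : ∀ (n k : ℕ) δ i j, i < j → m n δ i < m k δ j := by
    intro n k δ i j hij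
    apply he
    calc ω * toTypeRank i + n < ω * toTypeRank i + ω := by
          gcongr
          exact natCast_lt_omega0 n
      _ = ω * (toTypeRank i + 1) := (mul_add_one _ _).symm
      _ ≤ ω * toTypeRank j := by
          gcongr
          exact Order.add_one_le_of_lt (toTypeRank_lt_toTypeRank.2 hij)
      _ ≤ ω * toTypeRank j + k := le_add_right le_rfl
  have hstep : ∀ (n k : ℕ) δ j, n < k → m n δ j < m k δ j := by
    intro n k δ j h
    apply he
    gcongr
  refine ⟨⟨m 1, m 2, m 3, fun δ hδ => hS hδ, hmem 2, hmem 3, fun δ _ j => hstep 1 2 δ j (by simp),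
    fun δ _ j => hstep 2 3 δ j (by simp), fun δ _ i j h => hmono 3 1 δ i j h,
    fun δ hδ j => (hC δ hδ).1 (hmem 3 δ hδ j), fun γ hγ => ?_⟩⟩
  let X := {X : Set Ordinal.{u} | ∃ δ ∈ S, γ ∈ nacc (C δ) ∧ X = C δ ∩ Iio γ}
  have hX : #X ≤ #(ULift.{u + 1} lam.out) := by
    rw [Cardinal.mk_uLift, Cardinal.mk_out]
    exact hsmall γ hγ
  obtain ⟨f⟩ := hX
  have : Nonempty lam.out := by
    rw [← Cardinal.mk_ne_zero_iff, Cardinal.mk_out]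
    exact (Cardinal.aleph0_pos.trans hunc).ne'
  refine ⟨lam.out, fun δ => if h : C δ ∩ Iio γ ∈ X then (f ⟨_, h⟩).down else Classical.arbitrary _,
    (Cardinal.mk_out lam).le, ?_⟩
  intro δ hδ δ' hδ' j h h' heq i hi
  have hmX : ∀ ξ ∈ S, m 1 ξ j = γ → C ξ ∩ Iio γ ∈ X := by
    rintro ξ hξ rfl
    refine ⟨ξ, hξ, ?_, rfl⟩
    have hcast : ω * toTypeRank j + ((1 : ℕ) : Ordinal.{u}) = ω * toTypeRank j + 1 := by simp
    have := hmem 1 ξ hξ j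
    simp only [m, e, hcast] at this ⊢
    exact enumOrd_union_Ici_add_one_mem_nacc this
  simp only [dif_pos (hmX δ hδ h), dif_pos (hmX δ' hδ' h')] at heq
  have hCC : C δ ∩ Iio γ = C δ' ∩ Iio γ :=
    congrArg Subtype.val (f.injective (ULift.down_injective heq))
  have hγδ : ∀ ξ ∈ S, m 1 ξ j = γ → (C ξ ∪ Ici ξ) ∩ Iio γ = C ξ ∩ Iio γ := by
    rintro ξ hξ rfl
    ext x
    have := (hC ξ hξ).1 (hmem 1 ξ hξ j)
    simp only [mem_inter_iff, mem_union, mem_Ici, mem_Iio] at this ⊢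
    grind
  have hXX : (C δ ∪ Ici δ) ∩ Iio γ = (C δ' ∪ Ici δ') ∩ Iio γ := by
    rw [hγδ δ hδ h, hγδ δ' hδ' h', hCC]
  have hfin : ∀ n, m n δ i = m n δ' i := fun n =>
    (enumOrd_eq_of_inter_Iio_eq (not_bddAbove_union_Ici _ _) (not_bddAbove_union_Ici _ _) hXX _
      ((hmono n 1 δ i j hi).trans_eq h)).symm
  exact ⟨hfin 2, hfin 3⟩

end Ladders

/-! ### The order coding a subset of `λ`. -/

section Construction

variable {lam : Cardinal.{u}} {S : Set Ordinal.{u}} {C : Ordinal.{u} → Set Ordinal.{u}}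
  {K : Type u} [LinearOrder K]

open Classical in
/-- The sequence of digits attached to `δ`: the digit at `j` determines whether the cut of the
sequence is realized between the stages `m₂ δ j` and `m₃ δ j`. -/
noncomputable def codeSeq (D : DigitSystem lam K) (B : LadderSystem lam S C)
    (A : Set lam.ord.ToType) (δ : Ordinal.{u}) : Lex (lam.ord.ToType → K) :=
  toLex fun j => if j ∈ A then D.d (B.m₂ δ j) else D.c (B.m₃ δ j)

open Classical in
/-- The first `j` digits of `s`, followed by `k` and then by bottom digits. -/
noncomputable def cutoff (D : DigitSystem lam K) (s : Lex (lam.ord.ToType → K))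
    (j : lam.ord.ToType) (k : K) : Lex (lam.ord.ToType → K) :=
  toLex fun i => if i < j then s i else if i = j then k else D.bot

/-- The sequence `y` is presented at stage `r`. -/
inductive IsPresented (D : DigitSystem lam K) (B : LadderSystem lam S C)
    (A : Set lam.ord.ToType) : Lex (lam.ord.ToType → K) → Ordinal.{u} → Prop
  | codeSeq (δ : Ordinal.{u}) (hδ : δ ∈ S) : IsPresented D B A (codeSeq D B A δ) δ
  | cutoff (δ : Ordinal.{u}) (hδ : δ ∈ S) (j : lam.ord.ToType) (k : K) :
      IsPresented D B A (cutoff D (_root_.codeSeq D B A δ) j k) (max (B.m₁ δ j) (D.rank k))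

/-- The linear order whose invariant at each `δ ∈ S` takes the value `A`. -/
abbrev CodeOrder (D : DigitSystem lam K) (B : LadderSystem lam S C)
    (A : Set lam.ord.ToType) : Type u :=
  {y : Lex (lam.ord.ToType → K) // ∃ r, IsPresented D B A y r}

/-- The least stage at which an element of `CodeOrder D B A` is presented. -/
noncomputable def codeRank {D : DigitSystem lam K} {B : LadderSystem lam S C}
    {A : Set lam.ord.ToType} (y : CodeOrder D B A) : Ordinal.{u} :=
  sInf {r | IsPresented D B A y r}

variable {D : DigitSystem lam K} {B : LadderSystem lam S C} {A : Set lam.ord.ToType}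

theorem isPresented_codeRank (y : CodeOrder D B A) : IsPresented D B A y (codeRank y) :=
  csInf_mem (s := {r | IsPresented D B A y r}) y.2

theorem codeRank_le {y : CodeOrder D B A} {r : Ordinal.{u}} (h : IsPresented D B A y r) :
    codeRank y ≤ r :=
  csInf_le' h

theorem cutoff_apply_of_lt (s : Lex (lam.ord.ToType → K)) {i j : lam.ord.ToType} (k : K)
    (h : i < j) : cutoff D s j k i = s i :=
  if_pos h

theorem cutoff_apply_self (s : Lex (lam.ord.ToType → K)) (j : lam.ord.ToType) (k : K) :
    cutoff D s j k j = k :=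
  (if_neg (lt_irrefl j)).trans (if_pos rfl)

theorem cutoff_apply_of_gt (s : Lex (lam.ord.ToType → K)) {i j : lam.ord.ToType} (k : K)
    (h : j < i) : cutoff D s j k i = D.bot :=
  (if_neg h.not_gt).trans (if_neg h.ne')

theorem codeSeq_apply_of_mem {j : lam.ord.ToType} (h : j ∈ A) (δ : Ordinal.{u}) :
    codeSeq D B A δ j = D.d (B.m₂ δ j) :=
  if_pos h

theorem codeSeq_apply_of_notMem {j : lam.ord.ToType} (h : j ∉ A) (δ : Ordinal.{u}) :
    codeSeq D B A δ j = D.c (B.m₃ δ j) :=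
  if_neg h

theorem LadderSystem.m₃_lt_ord_succ (B : LadderSystem lam S C) {δ : Ordinal.{u}} (hδ : δ ∈ S)
    (j : lam.ord.ToType) : B.m₃ δ j < (Order.succ lam).ord :=
  (B.m₃_lt δ hδ j).trans (B.lt_of_mem δ hδ)

theorem LadderSystem.m₂_lt_ord_succ (B : LadderSystem lam S C) {δ : Ordinal.{u}} (hδ : δ ∈ S)
    (j : lam.ord.ToType) : B.m₂ δ j < (Order.succ lam).ord :=
  (B.m₂_lt_m₃ δ hδ j).trans (B.m₃_lt_ord_succ hδ j)

theorem LadderSystem.m₁_lt_ord_succ (B : LadderSystem lam S C) {δ : Ordinal.{u}} (hδ : δ ∈ S)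
    (j : lam.ord.ToType) : B.m₁ δ j < (Order.succ lam).ord :=
  (B.m₁_lt_m₂ δ hδ j).trans (B.m₂_lt_ord_succ hδ j)

theorem rank_codeSeq_le {δ : Ordinal.{u}} (hδ : δ ∈ S) (j : lam.ord.ToType) :
    D.rank (codeSeq D B A δ j) ≤ B.m₃ δ j + 1 := by
  by_cases h : j ∈ A
  · rw [codeSeq_apply_of_mem h, D.rank_d _ (B.m₂_lt_ord_succ hδ j)]
    exact (B.m₂_lt_m₃ δ hδ j).le.trans (lt_add_one _).le
  · rw [codeSeq_apply_of_notMem h, D.rank_c _ (B.m₃_lt_ord_succ hδ j)]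

theorem IsPresented.rank_apply_le {y : Lex (lam.ord.ToType → K)} {r : Ordinal.{u}}
    (h : IsPresented D B A y r) (i : lam.ord.ToType) : D.rank (y i) ≤ r := by
  cases h with
  | codeSeq δ hδ =>
    exact (rank_codeSeq_le hδ i).trans (Order.add_one_le_of_lt (B.m₃_lt _ hδ i))
  | cutoff δ hδ j k =>
    rcases lt_trichotomy i j with hij | rfl | hij
    · rw [cutoff_apply_of_lt _ _ hij]
      exact (rank_codeSeq_le hδ i).trans ((Order.add_one_le_of_lt (B.m₃_lt_m₁ δ hδ i j hij)).trans
        (le_max_left _ _))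
    · rw [cutoff_apply_self]
      exact le_max_right _ _
    · rw [cutoff_apply_of_gt _ _ hij, D.rank_bot]
      exact zero_le

theorem IsPresented.lt_ord_succ {y : Lex (lam.ord.ToType → K)} {r : Ordinal.{u}}
    (h : IsPresented D B A y r) : r < (Order.succ lam).ord := by
  cases h with
  | codeSeq δ hδ => exact B.lt_of_mem _ hδ
  | cutoff δ hδ j k => exact max_lt (B.m₁_lt_ord_succ hδ j) (D.isFiltrationRank.lt k)

theorem cutoff_codeSeq_congr {δ δ' : Ordinal.{u}} {j : lam.ord.ToType} (k : K)
    (h : ∀ i < j, B.m₂ δ i = B.m₂ δ' i ∧ B.m₃ δ i = B.m₃ δ' i) :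
    cutoff D (codeSeq D B A δ) j k = cutoff D (codeSeq D B A δ') j k := by
  funext i
  rcases lt_trichotomy i j with hij | rfl | hij
  · rw [cutoff_apply_of_lt _ _ hij, cutoff_apply_of_lt _ _ hij]
    by_cases hi : i ∈ A
    · rw [codeSeq_apply_of_mem hi, codeSeq_apply_of_mem hi, (h i hij).1]
    · rw [codeSeq_apply_of_notMem hi, codeSeq_apply_of_notMem hi, (h i hij).2]
  · rw [cutoff_apply_self, cutoff_apply_self]
  · rw [cutoff_apply_of_gt _ _ hij, cutoff_apply_of_gt _ _ hij]

/-- An element of rank below `α` is coded either by some `δ < α`, or by `γ = m₁ δ j < α`, the label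
of `δ` at `γ`, the position `j` and the last free digit. The label fixes the digits before `j`, so
there are at most `λ` codes. -/
theorem isFiltrationRank_codeRank (hlam : ℵ₀ ≤ lam) :
    IsFiltrationRank lam (codeRank : CodeOrder D B A → Ordinal.{u}) where
  lt y := (isPresented_codeRank y).lt_ord_succ
  card_le α hα := by
    choose W t hW ht using fun b : α.ToType => B.exists_label (toTypeRank b)
      ((toTypeRank_lt b).trans hα)
    let Z := α.ToType ⊕ (Σ b : α.ToType, W b × lam.ord.ToType × {k // D.rank k < α})
    let R : Lex (lam.ord.ToType → K) → Z → Prop := fun y => Sum.elim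
      (fun b => toTypeRank b ∈ S ∧ y = codeSeq D B A (toTypeRank b))
      (fun p => ∃ δ ∈ S, B.m₁ δ p.2.2.1 = toTypeRank p.1 ∧ t p.1 δ = p.2.1 ∧
        y = cutoff D (codeSeq D B A δ) p.2.2.1 p.2.2.2)
    have hR : ∀ y r, IsPresented D B A y r → r < α → ∃ z, R y z := by
      intro y r h hyα
      cases h with
      | codeSeq δ hδ =>
        obtain ⟨b, rfl⟩ := exists_toTypeRank_eq hyα
        exact ⟨Sum.inl b, hδ, rfl⟩
      | cutoff δ hδ j k =>
        obtain ⟨b, hb⟩ := exists_toTypeRank_eq (max_lt_iff.1 hyα).1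
        exact ⟨Sum.inr ⟨b, t b δ, j, k, (max_lt_iff.1 hyα).2⟩, δ, hδ, hb.symm, rfl, rfl⟩
    choose z hz using fun y : {y : CodeOrder D B A // codeRank y < α} =>
      hR y.1.1 _ (isPresented_codeRank y.1) y.2
    have hinj : Function.Injective z := by
      intro y y' h
      have h1 := hz y
      have h2 := hz y'
      rw [← h] at h2
      refine Subtype.ext (Subtype.ext ?_)
      generalize z y = w at h1 h2
      rcases w with b | ⟨b, w, j, k⟩
      · exact h1.2.trans h2.2.symm
      · obtain ⟨δ, hδ, hm, hl, hy⟩ := h1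
        obtain ⟨δ', hδ', hm', hl', hy'⟩ := h2
        exact hy.trans ((cutoff_codeSeq_congr _
          (ht b δ hδ δ' hδ' j hm hm' (hl.trans hl'.symm))).trans hy'.symm)
    refine (Cardinal.mk_le_of_injective hinj).trans ?_
    have hα' : #α.ToType ≤ lam := by
      rw [Cardinal.mk_toType]
      exact card_le_of_lt_ord_succ hα
    have hsigma : #(Σ b : α.ToType, W b × lam.ord.ToType × {k // D.rank k < α}) ≤ lam := by
      rw [Cardinal.mk_sigma]
      refine (Cardinal.sum_le_sum _ (fun _ => lam) fun b => ?_).trans ?_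
      · simp only [Cardinal.mk_prod, Cardinal.lift_id, Cardinal.mk_ord_toType]
        refine (mul_le_mul' (hW b) ((mul_le_mul' le_rfl (D.isFiltrationRank.card_le α hα)).trans
          (Cardinal.mul_eq_self hlam).le)).trans (Cardinal.mul_eq_self hlam).le
      · rw [Cardinal.sum_const, Cardinal.lift_id, Cardinal.lift_id]
        exact (mul_le_mul' hα' le_rfl).trans (Cardinal.mul_eq_self hlam).le
    rw [Cardinal.mk_sum, Cardinal.lift_id, Cardinal.lift_id]
    exact (add_le_add hα' hsigma).trans (Cardinal.add_eq_self hlam).le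

theorem IsFiltrationRank.mk_le (hlam : ℵ₀ ≤ lam) {W : Type u} {r : W → Ordinal.{u}}
    (hr : IsFiltrationRank lam r) : #W ≤ Order.succ lam := by
  have hlim := Cardinal.isSuccLimit_ord (hlam.trans (Order.le_succ lam))
  choose b hb using fun w => exists_toTypeRank_eq (hr.lt w)
  refine (Cardinal.mk_le_of_injective (β := Σ b : (Order.succ lam).ord.ToType,
    {w // r w < toTypeRank b + 1}) (f := fun w => ⟨b w, w, by rw [hb]; exact lt_add_one _⟩) ?_).trans
    ?_
  · intro w w' h
    have h1 : b w = b w' := congrArg Sigma.fst h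
    simp only [Sigma.mk.injEq] at h
    obtain ⟨-, h⟩ := h
    have key : ∀ (c c' : (Order.succ lam).ord.ToType) (p : {w // r w < toTypeRank c + 1})
        (p' : {w // r w < toTypeRank c' + 1}), c = c' → HEq p p' → p.1 = p'.1 := by
      rintro c _ p p' rfl h
      rw [eq_of_heq h]
    exact key _ _ _ _ h1 h
  · rw [Cardinal.mk_sigma]
    refine (Cardinal.sum_le_sum _ (fun _ => lam) fun b => ?_).trans ?_
    · exact hr.card_le _ (hlim.add_one_lt (toTypeRank_lt b))
    · rw [Cardinal.sum_const, Cardinal.lift_id, Cardinal.lift_id, Cardinal.mk_ord_toType]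
      exact (mul_le_mul' le_rfl (Order.le_succ lam)).trans
        (Cardinal.mul_eq_self (hlam.trans (Order.le_succ lam))).le

theorem mk_codeOrder (hlam : ℵ₀ ≤ lam) (hS : S.Nonempty) :
    #(CodeOrder D B A) = Order.succ lam := by
  refine ((isFiltrationRank_codeRank hlam).mk_le hlam).antisymm ?_
  obtain ⟨δ, hδ⟩ := hS
  obtain ⟨j⟩ : Nonempty lam.ord.ToType := by
    rw [← Cardinal.mk_ne_zero_iff, Cardinal.mk_ord_toType]
    exact (Cardinal.aleph0_pos.trans_le hlam).ne'
  rw [← Cardinal.mk_ord_toType (Order.succ lam)]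
  -- Truncating one sequence at a fixed `j` and inserting the `λ⁺` digits `d ε`, distinguished by
  -- their ranks, gives `λ⁺` elements.
  refine Cardinal.mk_le_of_injective (f := fun ε => (⟨_, _, IsPresented.cutoff δ hδ j
    (D.d (toTypeRank ε))⟩ : CodeOrder D B A)) fun ε ε' h => ?_
  have h1 : cutoff D (codeSeq D B A δ) j (D.d (toTypeRank ε)) j =
      cutoff D (codeSeq D B A δ) j (D.d (toTypeRank ε')) j :=
    congrFun (congrArg Subtype.val h) j
  rw [cutoff_apply_self, cutoff_apply_self] at h1
  have h2 := congrArg D.rank h1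
  rw [D.rank_d _ (toTypeRank_lt _), D.rank_d _ (toTypeRank_lt _)] at h2
  exact toTypeRank_injective h2

/-- The first difference of `z` from `x`, or from `y`, occurs at or before `j`, where `x` and `y`
coincide. -/
theorem lex_lt_iff_of_agree {I : Type u} [LinearOrder I] [WellFoundedLT I]
    {x y z : Lex (I → K)} {j : I} (h : ∀ i ≤ j, y i = x i) (hz : z j ≠ x j) :
    (z < y ↔ z < x) ∧ (y < z ↔ x < z) := by
  have key : ∀ x y z : Lex (I → K), (∀ i ≤ j, y i = x i) → z j ≠ x j →
      (z < y → z < x) ∧ (y < z → x < z) := by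
    intro x y z h hz
    have hle : ∀ i, (∀ k < i, z k = y k) → i ≤ j := fun i hi =>
      not_lt.1 fun hji => hz ((hi j hji).trans (h j le_rfl))
    constructor
    · rintro ⟨i, hi, hlt⟩
      have hij := hle i hi
      exact ⟨i, fun k hk => (hi k hk).trans (h k (hk.le.trans hij)), hlt.trans_eq (h i hij)⟩
    · rintro ⟨i, hi, hlt⟩
      have hij := hle i fun k hk => (hi k hk).symm
      exact ⟨i, fun k hk => (h k (hk.le.trans hij)).symm.trans (hi k hk),
        (h i hij).symm.trans_lt hlt⟩
  have h1 := key x y z h hz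
  have h2 := key y x z (fun i hi => (h i hi).symm) fun heq => hz (heq.trans (h j le_rfl))
  exact ⟨⟨h1.1, h2.1⟩, ⟨h1.2, h2.2⟩⟩

/-- If `y` first leaves the sequence at `j`, insert a separator of the digits there. If it leaves
earlier, the bottom or top digit at `j` moves the truncation slightly towards `y` without passing
it. -/
theorem exists_cutoff_between {δ : Ordinal.{u}} (hδ : δ ∈ S) {j : lam.ord.ToType} (hj : j ∉ A)
    {y : Lex (lam.ord.ToType → K)} (hy : y j ≠ codeSeq D B A δ j) :
    ∃ q, D.rank q = 0 ∧
      ((y < cutoff D (codeSeq D B A δ) j q ∧ cutoff D (codeSeq D B A δ) j q < codeSeq D B A δ) ∨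
      (codeSeq D B A δ < cutoff D (codeSeq D B A δ) j q ∧
        cutoff D (codeSeq D B A δ) j q < y)) := by
  set x := codeSeq D B A δ with hx
  have hxj : x j = D.c (B.m₃ δ j) := codeSeq_apply_of_notMem hj δ
  have hlt := B.m₃_lt_ord_succ hδ j
  have hcut_lt : ∀ q, q < x j → cutoff D x j q < x := fun q hq =>
    ⟨j, fun i hi => cutoff_apply_of_lt _ _ hi, (cutoff_apply_self _ _ _).trans_lt hq⟩
  have hlt_cut : ∀ q, x j < q → x < cutoff D x j q := fun q hq =>
    ⟨j, fun i hi => (cutoff_apply_of_lt _ _ hi).symm, hq.trans_eq (cutoff_apply_self _ _ _).symm⟩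
  by_cases hagree : ∀ i < j, y i = x i
  · obtain ⟨q, hq0, hq⟩ := D.separated _ hlt (y j) (hxj ▸ hy)
    rw [← hxj] at hq
    refine ⟨q, hq0, hq.imp (fun h => ⟨⟨j, fun i hi => ?_, ?_⟩, hcut_lt q h.2⟩)
      fun h => ⟨hlt_cut q h.1, ⟨j, fun i hi => ?_, ?_⟩⟩⟩
    · exact (hagree i hi).trans (cutoff_apply_of_lt _ _ hi).symm
    · exact h.1.trans_eq (cutoff_apply_self _ _ _).symm
    · exact (cutoff_apply_of_lt _ _ hi).trans (hagree i hi).symm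
    · exact (cutoff_apply_self _ _ _).trans_lt h.2
  · have hne : y ≠ x := fun h => hagree fun i _ => congrFun h i
    have hij : ∀ i, (∀ k < i, y k = x k) → i < j := fun i hi =>
      not_le.1 fun hji => hagree fun k hk => hi k (hk.trans_le hji)
    rcases lt_or_gt_of_ne hne with ⟨i, hi, h⟩ | ⟨i, hi, h⟩
    · have hij := hij i hi
      exact ⟨D.bot, D.rank_bot, Or.inl ⟨⟨i,
        fun k hk => (hi k hk).trans (cutoff_apply_of_lt _ _ (hk.trans hij)).symm,
        h.trans_eq (cutoff_apply_of_lt _ _ hij).symm⟩, hcut_lt _ (hxj ▸ D.bot_lt_c _ hlt)⟩⟩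
    · have hij := hij i fun k hk => (hi k hk).symm
      exact ⟨D.top, D.rank_top, Or.inr ⟨hlt_cut _ (hxj ▸ D.c_lt_top _ hlt), ⟨i,
        fun k hk => (cutoff_apply_of_lt _ _ (hk.trans hij)).trans (hi k hk),
        (cutoff_apply_of_lt _ _ hij).trans_lt h⟩⟩⟩

/-- An element of rank `r` has only digits of rank at most `r`. For `j ∉ A`, rank below `m₃`
excludes the digit `c (m₃)`, so a truncation with a digit of rank `0` at `j`, of rank at most `m₁ <
m₂`, separates. For `j ∈ A`, the truncation keeping the digit `d (m₂)` has rank below `m₃`, and no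
element of rank below `m₂` has that digit at `j`. -/
theorem exists_sameCut_codeSeq_iff {δ : Ordinal.{u}} (hδ : δ ∈ S) (j : lam.ord.ToType) :
    (∃ y : CodeOrder D B A, codeRank y < B.m₃ δ j ∧
      SameCut (fun w : CodeOrder D B A => codeRank w < B.m₂ δ j) y
        ⟨codeSeq D B A δ, δ, .codeSeq δ hδ⟩) ↔ j ∈ A := by
  constructor
  · rintro ⟨y, hy, hcut⟩
    by_contra hj
    have hne : y.1 j ≠ codeSeq D B A δ j := by
      intro h
      have h1 := ((isPresented_codeRank y).rank_apply_le j).trans_lt hy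
      rw [h, codeSeq_apply_of_notMem hj, D.rank_c _ (B.m₃_lt_ord_succ hδ j)] at h1
      exact h1.not_gt (lt_add_one _)
    obtain ⟨q, hq0, hq⟩ := exists_cutoff_between hδ hj hne
    have hp := IsPresented.cutoff (D := D) (B := B) (A := A) δ hδ j q
    have hz := hcut ⟨_, _, hp⟩ ((codeRank_le hp).trans_lt (by
      rw [hq0]
      exact max_lt (B.m₁_lt_m₂ δ hδ j) ((zero_le).trans_lt (B.m₁_lt_m₂ δ hδ j))))
    rcases hq with ⟨h1, h2⟩ | ⟨h1, h2⟩
    · exact h2.not_gt (hz.2.1 h1)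
    · exact h1.not_gt (hz.1.1 h2)
  · intro hj
    have hp := IsPresented.cutoff (D := D) (B := B) (A := A) δ hδ j (D.d (B.m₂ δ j))
    refine ⟨⟨_, _, hp⟩, (codeRank_le hp).trans_lt ?_, fun z hz => ?_⟩
    · rw [D.rank_d _ (B.m₂_lt_ord_succ hδ j)]
      exact max_lt ((B.m₁_lt_m₂ δ hδ j).trans (B.m₂_lt_m₃ δ hδ j)) (B.m₂_lt_m₃ δ hδ j)
    · refine lex_lt_iff_of_agree (x := codeSeq D B A δ) (z := z.1) (j := j) (fun i hi => ?_) ?_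
      · rcases hi.lt_or_eq with hi | rfl
        · exact cutoff_apply_of_lt _ _ hi
        · exact (cutoff_apply_self _ _ _).trans (codeSeq_apply_of_mem hj δ).symm
      · intro h
        have h1 := ((isPresented_codeRank z).rank_apply_le j).trans_lt hz
        rw [h, codeSeq_apply_of_mem hj, D.rank_d _ (B.m₂_lt_ord_succ hδ j)] at h1
        exact lt_irrefl _ h1

end Construction

/-! ### Counting invariants and the universality number. -/

section Main

/-- Fewer than `2 ^ λ` linear orders of size `λ⁺` do not suffice to embed all linear orders of
size `λ⁺`. -/
theorem exists_linearOrder_not_embedding {lam : Cardinal.{u}} (hunc : ℵ₀ < lam)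
    (hpow : Order.succ lam < 2 ^ lam) {S : Set Ordinal.{u}}
    (hS : S ⊆ Iio (Order.succ lam).ord) (hScof : ∀ δ ∈ S, δ.cof = lam)
    {C : Ordinal.{u} → Set Ordinal.{u}} (hC : IsClubSystem S C)
    (hguess : GuessesClubs (Order.succ lam).ord S C)
    (hsmall : ∀ α < (Order.succ lam).ord,
      #{X : Set Ordinal.{u} | ∃ δ ∈ S, α ∈ nacc (C δ) ∧ X = C δ ∩ Iio α}
        ≤ Cardinal.lift.{u + 1} lam)
    {ι : Type (u + 1)} (hι : #ι < Cardinal.lift.{u + 1} (2 ^ lam)) (M : ι → Type u)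
    [∀ i, LinearOrder (M i)] (hM : ∀ i, #(M i) = Order.succ lam) :
    ∃ (N : Type u) (_ : LinearOrder N), #N = Order.succ lam ∧ ∀ i, IsEmpty (N ↪o M i) := by
  have hlam := hunc.le
  have hlam' : ℵ₀ ≤ Order.succ lam := hlam.trans (Order.le_succ lam)
  obtain ⟨B⟩ := nonempty_ladderSystem hunc hS hScof hC hsmall
  obtain ⟨K, _, ⟨D⟩⟩ := exists_digitSystem hlam
  have hrank : ∀ i, ∃ r : M i → Ordinal.{u}, IsFiltrationRank lam r := fun i => by
    obtain ⟨e⟩ := Cardinal.eq.1 ((hM i).trans (Cardinal.mk_ord_toType _).symm)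
    exact ⟨_, isFiltrationRank_toTypeRank.comp_injective e.injective⟩
  choose r hr using hrank
  let T := (Order.succ lam).ord.ToType
  let inv : (Σ i : ι, T × M i) → Set lam.ord.ToType := fun p =>
    {j | ∃ y, r p.1 y < B.m₃ (toTypeRank p.2.1) j ∧
      SameCut (fun w => r p.1 w < B.m₂ (toTypeRank p.2.1) j) y p.2.2}
  -- There are at most `#ι · λ⁺` invariants, and both factors are below `2^λ`.
  obtain ⟨A, hA⟩ : ∃ A, A ∉ range inv := by
    by_contra! hall
    have hsurj : Function.Surjective inv := hall
    have h1 := Cardinal.lift_mk_le_lift_mk_of_surjective hsurj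
    have h2 : #(Σ i : ι, T × M i) < Cardinal.lift.{u + 1} (2 ^ lam) := by
      have hsum : #(Σ i : ι, T × M i) = #ι * Cardinal.lift.{u + 1} (Order.succ lam) := by
        rw [Cardinal.mk_sigma]
        have : ∀ i, #(T × M i) = Order.succ lam := fun i => by
          rw [Cardinal.mk_prod, Cardinal.lift_id, Cardinal.lift_id, hM i, Cardinal.mk_ord_toType,
            Cardinal.mul_eq_self hlam']
        rw [funext this, Cardinal.sum_const]
        exact congrArg (· * _) (Cardinal.lift_id'.{u, u + 1} _)
      rw [hsum]
      refine Cardinal.mul_lt_of_lt ?_ hι (Cardinal.lift_lt.2 hpow)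
      exact Cardinal.aleph0_le_lift.2 (hlam.trans (Cardinal.cantor lam).le)
    rw [Cardinal.mk_set, Cardinal.mk_ord_toType] at h1
    exact absurd h2 (not_lt.2 (by simpa using h1))
  -- Guessing the trivial club shows that `S` is nonempty, so the coded order has size `λ⁺`.
  obtain ⟨δ₀, hδ₀, -⟩ := hguess (Iio (Order.succ lam).ord) ⟨subset_rfl, by
    rw [show ((fun x : Iio (Order.succ lam).ord => (x : Ordinal.{u})) ⁻¹'
      Iio (Order.succ lam).ord) = Set.univ from eq_univ_of_forall fun x => x.2]
    exact IsClub.univ⟩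
  refine ⟨CodeOrder D B A, inferInstance, mk_codeOrder hlam ⟨δ₀, hδ₀.1⟩, fun i => ⟨fun f => hA ?_⟩⟩
  obtain ⟨E, hE, hpres⟩ := exists_isClubIn_sameCut_iff hlam (isFiltrationRank_codeRank hlam)
    (hr i) f
  obtain ⟨δ, ⟨hδ, -⟩, hδE⟩ := hguess E hE
  obtain ⟨b, rfl⟩ := exists_toTypeRank_eq (hS hδ)
  refine ⟨⟨i, b, f ⟨_, _, .codeSeq _ hδ⟩⟩, ?_⟩
  ext j
  exact (hpres _ (hδE (B.m₂_mem _ hδ j)) _ (hδE (B.m₃_mem _ hδ j)) (B.m₂_lt_m₃ _ hδ j) _).symm.trans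
    (exists_sameCut_codeSeq_iff hδ j)

open FirstOrder.Language in
theorem exists_linearOrder_of_modelType_Tord
    (M : FirstOrder.Language.Theory.ModelType.{0, 0, u} Tord) :
    ∃ _ : LinearOrder M, Language.order.OrderedStructure M := by
  classical
  have : M ⊨ Language.order.linearOrderTheory := M.is_model
  let : LinearOrder M := Language.order.linearOrderOfModels M
  refine ⟨this, ⟨fun x => ?_⟩⟩
  have hx : x = ![x 0, x 1] := by
    ext i
    fin_cases i <;> rfl
  exact iff_of_eq (congrArg (Structure.RelMap (leSymb : Language.order.Relations 2)) hx)

end Main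

theorem mainTheorem4 (lam : Cardinal.{u}) (hreg : lam.IsRegular) (hunc : ℵ₀ < lam)
    (hpow : Order.succ lam < 2 ^ lam)
    (S : Set Ordinal.{u}) (hS : IsStationaryIn S (Order.succ lam).ord)
    (hScof : ∀ δ ∈ S, δ.cof = lam)
    (C : Ordinal.{u} → Set Ordinal.{u}) (hC : IsClubSystem S C)
    (hguess : GuessesClubs (Order.succ lam).ord S C)
    (hsmall : ∀ α < (Order.succ lam).ord,
      #{X : Set Ordinal.{u} | ∃ δ ∈ S, α ∈ nacc (C δ) ∧ X = C δ ∩ Iio α}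
        ≤ Cardinal.lift.{u + 1} lam) :
    (¬ ∃ (M : Type u) (_ : LinearOrder M), IsUniversalLinearOrder (Order.succ lam) M) ∧
      Cardinal.lift.{u + 1} (2 ^ lam) ≤ univNumber (Order.succ lam) Tord := by
  constructor
  · rintro ⟨M, _, hM, huniv⟩
    obtain ⟨N, _, hN, hemp⟩ := exists_linearOrder_not_embedding hunc hpow hS.1 hScof hC hguess
      hsmall (ι := PUnit) (by
        rw [Cardinal.mk_punit]
        exact Cardinal.one_lt_aleph0.trans_le
          (Cardinal.aleph0_le_lift.2 (hunc.trans (Cardinal.cantor lam)).le))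
      (fun _ => M) (fun _ => hM)
    exact not_isEmpty_iff.2 (huniv N hN) (hemp PUnit.unit)
  -- The family of all models of size `λ⁺` shows that the infimum is over a nonempty set; otherwise
  -- it would be `0` by convention.
  · refine le_csInf ⟨_, {M | #M = Order.succ lam}, rfl, fun M hM => hM, fun N hN => ⟨N, hN,
      ⟨Language.Embedding.refl _ _⟩⟩⟩ ?_
    rintro _ ⟨P, rfl, hP, huniv⟩
    by_contra! hlt
    choose lo hlo using fun M : P => exists_linearOrder_of_modelType_Tord M.1
    obtain ⟨N, _, hN, hemp⟩ := exists_linearOrder_not_embedding hunc hpow hS.1 hScof hC hguess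
      hsmall hlt (fun M : P => M.1) (fun M => hP M.1 M.2)
    let : Language.order.Structure N := Language.orderStructure N
    have : Language.order.OrderedStructure N := ⟨fun _ => Iff.rfl⟩
    have : N ⊨ Tord := Language.model_linearOrder
    have : Nonempty N := by
      rw [← Cardinal.mk_ne_zero_iff, hN]
      exact (Cardinal.aleph0_pos.trans (hunc.trans (Order.lt_succ lam))).ne'
    obtain ⟨M, hM, ⟨φ⟩⟩ := huniv (Language.Theory.ModelType.of Tord N) hN
    let ψ : N ↪[Language.order] M := φ
    let : LinearOrder M := lo ⟨M, hM⟩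
    have : Language.order.OrderedStructure M := hlo ⟨M, hM⟩
    have hmono : StrictMono ψ := Language.HomClass.strictMono ψ
    exact (hemp ⟨M, hM⟩).false (OrderEmbedding.ofStrictMono ψ hmono)
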